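/- Conventions. A pointed dcpo is a partially ordered set $X$ that has a least element and in which every (non-empty) directed subset has a least upper bound. A map between posets is Scott-continuous if it preserves all existing least upper bounds of directed subsets (hence is monotonic). Write $\uparrow E=\{y\mid \exists x\in E,\ x\le y\}$ and $\uparrow x=\uparrow\{x\}$. Let $\mathrm{Fin}(X)$ be the set of all $\uparrow E$ with $E\subseteq X$ finite and non-empty, ordered by reverse inclusion $\supseteq$. Maps into a poset are ordered pointwise. A quasi-deflation on $X$ is a Scott-continuous map $\varphi:X\to\mathrm{Fin}(X)$ with finite image such that $x\in\varphi(x)$ for every $x\in X$. A controlled quasi-deflation on $X$ is a pair $(f,\varphi)$ of a Scott-continuous map $f:X\to X$ and a quasi-deflation $\varphi$ on $X$ such that $\varphi(x)\subseteq\,\uparrow f(x)$ for every $x\in X$. A controlled $\omega\mathsf{QRB}$-domain is a pointed dcpo $X$ for which there is a sequence $(f_i,\varphi_i)_{i\in\mathbb N}$ of controlled quasi-deflations that is non-decreasing (for $i\le j$ and every $x\in X$, $f_i(x)\le f_j(x)$ and $\varphi_i(x)\supseteq\varphi_j(x)$) and satisfies $x=\sup_{i\in\mathbb N} f_i(x)$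 for every $x\in X$. A map $f:X\to X$ is finitely separated from the identity if there is a finite set $M\subseteq X$ such that for every $x\in X$ there is an $m\in M$ with $f(x)\le m\le x$. An $\mathsf{FS}$-domain is a pointed dcpo $X$ with a directed family of Scott-continuous maps $f_i:X\to X$, each finitely separated from the identity, such that $x=\sup_i f_i(x)$ for every $x\in X$. An $\omega\mathsf{FS}$-domain is defined in the same way with a non-decreasing sequence $(f_i)_{i\in\mathbb N}$ instead of a directed family. Theorem. For every pointed dcpo $X$: 1. $X$ is a controlled $\omega\mathsf{QRB}$-domain if and only if $X$ is an $\omega\mathsf{FS}$-domain; 2. $X$ is an $\omega\mathsf{FS}$-domain if and only if $X$ is an $\mathsf{FS}$-domain whose Scott topology has a countable base. Moreover, the category whose objects are the controlled $\omega\mathsf{QRB}$-domains (equivalently, the $\omega\mathsf{FS}$-domains) and whose morphisms are all Scott-continuous maps between them is Cartesian-closed. -/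

import Mathlib

open CategoryTheory

universe u

/-- The finitary compacts of a poset `X`: the upward closures of the non-empty finite subsets of `X`.
Upper sets are ordered by reverse inclusion in Mathlib, so this subtype is ordered by `⊇`. -/
def FinitaryCompact (X : Type u) [PartialOrder X] : Type u :=
  {U : UpperSet X // ∃ E : Finset X, E.Nonempty ∧ U = upperClosure (E : Set X)}

instance FinitaryCompact.instPartialOrder (X : Type u) [PartialOrder X] :
    PartialOrder (FinitaryCompact X) :=
  inferInstanceAs
    (PartialOrder {U : UpperSet X // ∃ E : Finset X, E.Nonempty ∧ U = upperClosure (E : Set X)})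

/-- A finitary compact as a set of points. -/
def FinitaryCompact.toSet {X : Type u} [PartialOrder X] (Q : FinitaryCompact X) : Set X :=
  (Q.1 : Set X)

/-- The order on finitary compacts is reverse inclusion. -/
theorem FinitaryCompact.le_iff {X : Type u} [PartialOrder X] (Q Q' : FinitaryCompact X) :
    Q ≤ Q' ↔ Q'.toSet ⊆ Q.toSet := Iff.rfl

/-- A quasi-deflation on a poset `X`: a Scott-continuous map `φ` from `X` to the finitary compacts
(ordered by reverse inclusion) with `x ∈ φ x` for every `x` and with finite image. -/
structure IsQuasiDeflation {X : Type u} [PartialOrder X] (φ : X → FinitaryCompact X) : Prop where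
  scottContinuous : ScottContinuous φ
  mem (x : X) : x ∈ (φ x).toSet
  finite_range : (Set.range φ).Finite

/-- A controlled quasi-deflation: a Scott-continuous map `f` (the control) and a quasi-deflation `φ`
with `φ x ⊆ ↑ f x` for every `x`. -/
structure IsControlledQuasiDeflation {X : Type u} [PartialOrder X]
    (f : X → X) (φ : X → FinitaryCompact X) : Prop where
  control_scottContinuous : ScottContinuous f
  isQuasiDeflation : IsQuasiDeflation φ
  subset_Ici (x : X) : (φ x).toSet ⊆ Set.Ici (f x)

/-- A controlled `ωQRB`-domain: a pointed dcpo with a non-decreasing sequence (in the pointwise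
ordering of pairs) of controlled quasi-deflations `(f i, φ i)` such that `x = sup_i f i x` for
every `x`. Mathlib's class `CompletePartialOrder` is that of pointed dcpos. -/
def IsControlledOmegaQRBDomain (X : Type u) [CompletePartialOrder X] : Prop :=
  ∃ (f : ℕ → X → X) (φ : ℕ → X → FinitaryCompact X),
    (∀ i, IsControlledQuasiDeflation (f i) (φ i)) ∧
    Monotone (fun i => (f i, φ i)) ∧
    ∀ x, IsLUB (Set.range fun i => f i x) x

/-- `f` is finitely separated from the identity: there is a finite set `M` such that every `x`
admits `m ∈ M` with `f x ≤ m ≤ x`. -/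
def FinitelySeparatedFromId {X : Type u} [PartialOrder X] (f : X → X) : Prop :=
  ∃ M : Finset X, ∀ x, ∃ m ∈ M, f x ≤ m ∧ m ≤ x

/-- An `FS`-domain: a pointed dcpo with a directed family of Scott-continuous self-maps, each
finitely separated from the identity, whose pointwise supremum is the identity. -/
def IsFSDomain (X : Type u) [CompletePartialOrder X] : Prop :=
  ∃ D : Set (X → X), D.Nonempty ∧ DirectedOn (· ≤ ·) D ∧
    (∀ f ∈ D, ScottContinuous f ∧ FinitelySeparatedFromId f) ∧
    ∀ x, IsLUB ((fun f : X → X => f x) '' D) x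

/-- An `ωFS`-domain: as an `FS`-domain, with a non-decreasing sequence of maps instead of a
directed family. -/
def IsOmegaFSDomain (X : Type u) [CompletePartialOrder X] : Prop :=
  ∃ f : ℕ → X → X,
    (∀ i, ScottContinuous (f i) ∧ FinitelySeparatedFromId (f i)) ∧
    Monotone f ∧
    ∀ x, IsLUB (Set.range fun i => f i x) x

/-- The Scott topology of `X` has a countable base. -/
def IsCountablyBased (X : Type u) [CompletePartialOrder X] : Prop :=
  @SecondCountableTopology X (Topology.scott X Set.univ)

/-- Pointed dcpos, as the objects of a category. -/
structure PointedDcpo : Type (u + 1) where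
  carrier : Type u
  [str : CompletePartialOrder carrier]

attribute [instance] PointedDcpo.str

instance PointedDcpo.instCoeSort : CoeSort PointedDcpo.{u} (Type u) := ⟨PointedDcpo.carrier⟩

/-- The morphisms between pointed dcpos are all the Scott-continuous maps. -/
instance PointedDcpo.instCategory : Category.{u} PointedDcpo.{u} where
  Hom X Y := {f : X → Y // ScottContinuous f}
  id X := ⟨id, ScottContinuous.id⟩
  comp f g := ⟨g.1 ∘ f.1, f.2.comp g.2⟩

/-- The controlled `ωQRB`-domains, as a property of pointed dcpos. -/
def controlledOmegaQRB : ObjectProperty PointedDcpo.{u} :=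
  fun X => IsControlledOmegaQRBDomain X

/-- A category is Cartesian-closed: it admits finite products (chosen as a cartesian monoidal
structure) for which every functor `A × -` has a right adjoint. -/
def IsCartesianClosed (C : Type*) [Category C] : Prop :=
  ∃ _ : CartesianMonoidalCategory C, Nonempty (MonoidalClosed C)

/-! If `f` is Scott-continuous and finitely separated from the identity by `M`, then along a
directed set the members of `M` above `f x` stabilise (`ScottContinuous.exists_mem_forall_le_imp`).
Hence `f x` is way below `x`, and the finite data at each stage behave continuously.

The generators of the finitely many values of a quasi-deflation separate its control. Conversely, `x
↦ ↑{m ∈ M | g x ≤ m}` is a quasi-deflation whenever `g ≤ f`; these maps form a non-decreasing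
sequence after passing to a subsequence and to cubes, thanks to `IsFSSequence.eventually_sq_le`.

Recording which members of `M` lie above `f y` yields a countable base. Conversely, countably many
maps of an FS family, one for each pair of basic opens, already have supremum the identity.

For Cartesian closure it suffices that products and function spaces stay in the class; the function
space uses `h ↦ g² ∘ h ∘ f²`. -/

/-! ### Finite separation, FS-sequences and quasi-deflations. -/

section Order

variable {X : Type u} [PartialOrder X]

/-- Over a finite set of candidates, the upper bounds of the image of a directed supremum under a
Scott-continuous map are already the upper bounds of the image of some member. -/
theorem ScottContinuous.exists_mem_forall_le_imp {Y : Type*} [Preorder Y] {f : X → Y}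
    (hf : ScottContinuous f) (M : Finset Y) {d : Set X} (hne : d.Nonempty)
    (hd : DirectedOn (· ≤ ·) d) {a : X} (ha : IsLUB d a) :
    ∃ e ∈ d, ∀ m ∈ M, f e ≤ m → f a ≤ m := by
  classical
  induction M using Finset.induction_on with
  | empty =>
    obtain ⟨e, he⟩ := hne
    exact ⟨e, he, by simp⟩
  | insert m M _ ih =>
    obtain ⟨e, he, h⟩ := ih
    by_cases hm : f a ≤ m
    · refine ⟨e, he, fun m' hm' h' => ?_⟩
      rcases Finset.mem_insert.1 hm' with rfl | hm'
      exacts [hm, h m' hm' h']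
    -- Once one image fails to be below `m`, so do all later ones, and the claim for `m` becomes
    -- vacuous.
    · have : ∃ e' ∈ d, ¬ f e' ≤ m := by
        by_contra! hall
        exact hm ((hf hne hd ha).2 (by rintro _ ⟨x, hx, rfl⟩; exact hall x hx))
      obtain ⟨e', he', h'⟩ := this
      obtain ⟨c, hc, hec, hec'⟩ := hd e he e' he'
      refine ⟨c, hc, fun m' hm' hle => ?_⟩
      rcases Finset.mem_insert.1 hm' with rfl | hm'
      · exact absurd ((hf.monotone hec').trans hle) h'
      · exact h m' hm' ((hf.monotone hec).trans hle)

theorem FinitelySeparatedFromId.le_self {f : X → X} (h : FinitelySeparatedFromId f) (x : X) :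
    f x ≤ x := by
  obtain ⟨M, hM⟩ := h
  obtain ⟨m, -, h₁, h₂⟩ := hM x
  exact h₁.trans h₂

theorem FinitelySeparatedFromId.of_le {f g : X → X} (h : FinitelySeparatedFromId f)
    (hgf : ∀ x, g x ≤ f x) : FinitelySeparatedFromId g := by
  obtain ⟨M, hM⟩ := h
  refine ⟨M, fun x => ?_⟩
  obtain ⟨m, hm, h₁, h₂⟩ := hM x
  exact ⟨m, hm, (hgf x).trans h₁, h₂⟩

/-- A Scott-continuous map finitely separated from the identity maps every point way below it. -/
theorem FinitelySeparatedFromId.exists_le_of_isLUB {f : X → X} (h : FinitelySeparatedFromId f)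
    (hf : ScottContinuous f) {d : Set X} (hne : d.Nonempty)
    (hd : DirectedOn (· ≤ ·) d) {a : X} (ha : IsLUB d a) : ∃ e ∈ d, f a ≤ e := by
  obtain ⟨M, hM⟩ := h
  obtain ⟨e, he, h⟩ := hf.exists_mem_forall_le_imp M hne hd ha
  obtain ⟨m, hm, h₁, h₂⟩ := hM e
  exact ⟨e, he, (h m hm h₁).trans h₂⟩

/-- A non-decreasing sequence of Scott-continuous self-maps finitely separated from the identity,
with pointwise supremum the identity. -/
structure IsFSSequence (f : ℕ → X → X) : Prop where
  scottContinuous (i : ℕ) : ScottContinuous (f i)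
  separated (i : ℕ) : FinitelySeparatedFromId (f i)
  mono : Monotone f
  isLUB (x : X) : IsLUB (Set.range fun i => f i x) x

theorem isOmegaFSDomain_iff {X : Type u} [CompletePartialOrder X] :
    IsOmegaFSDomain X ↔ ∃ f : ℕ → X → X, IsFSSequence f :=
  ⟨fun ⟨f, h₁, h₂, h₃⟩ => ⟨f, fun i => (h₁ i).1, fun i => (h₁ i).2, h₂, h₃⟩,
    fun ⟨f, h⟩ => ⟨f, fun i => ⟨h.scottContinuous i, h.separated i⟩, h.mono, h.isLUB⟩⟩

namespace IsFSSequence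

variable {f g : ℕ → X → X}

theorem le_self (hf : IsFSSequence f) (i : ℕ) (x : X) : f i x ≤ x := (hf.separated i).le_self x

theorem monotone_apply (hf : IsFSSequence f) (i : ℕ) : Monotone (f i) :=
  (hf.scottContinuous i).monotone

theorem comp_le_comp (hf : IsFSSequence f) (hg : IsFSSequence g) {i j : ℕ} (h : i ≤ j) (x : X) :
    g i (f i x) ≤ g j (f j x) :=
  (hg.monotone_apply i (hf.mono h x)).trans (hg.mono h _)

theorem comp (hf : IsFSSequence f) (hg : IsFSSequence g) : IsFSSequence fun i => g i ∘ f i where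
  scottContinuous i := (hf.scottContinuous i).comp (hg.scottContinuous i)
  separated i := (hf.separated i).of_le fun x => hg.le_self i (f i x)
  mono _ _ h x := comp_le_comp hf hg h x
  isLUB x := by
    refine ⟨?_, fun b hb => (hf.isLUB x).2 ?_⟩
    · rintro _ ⟨i, rfl⟩
      exact (hg.le_self i _).trans (hf.le_self i x)
    · rintro _ ⟨k, rfl⟩
      refine (hg.isLUB (f k x)).2 ?_
      rintro _ ⟨n, rfl⟩
      exact ((hg.mono (le_max_left n k) _).trans
        (hg.monotone_apply _ (hf.mono (le_max_right n k) x))).trans (hb ⟨max n k, rfl⟩)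

theorem subsequence (hf : IsFSSequence f) {n : ℕ → ℕ} (hn : StrictMono n) :
    IsFSSequence fun i => f (n i) where
  scottContinuous i := hf.scottContinuous _
  separated i := hf.separated _
  mono := hf.mono.comp hn.monotone
  isLUB x := by
    refine ⟨?_, fun b hb => (hf.isLUB x).2 ?_⟩
    · rintro _ ⟨i, rfl⟩
      exact hf.le_self _ x
    · rintro _ ⟨k, rfl⟩
      exact (hf.mono hn.le_apply x).trans (hb ⟨k, rfl⟩)

/-- Each square of a member of an FS-sequence is eventually below the members of another. -/
theorem eventually_sq_le (hf : IsFSSequence f) (hg : IsFSSequence g) (i : ℕ) :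
    ∃ n, ∀ j, n ≤ j → ∀ x, f i (f i x) ≤ g j x := by
  obtain ⟨M, hM⟩ := hf.separated i
  have key : ∀ m, ∃ n, f i m ≤ g n m := by
    intro m
    have hmono : Monotone fun n => g n m := fun _ _ h => hg.mono h m
    obtain ⟨_, ⟨n, rfl⟩, hn⟩ := (hf.separated i).exists_le_of_isLUB (hf.scottContinuous i)
      (Set.range_nonempty _) hmono.directed_le.directedOn_range (hg.isLUB m)
    exact ⟨n, hn⟩
  choose n hn using key
  -- One application of `f i` reaches a separator `m ≤ x`; the second is absorbed by `g j m`,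
  -- uniformly as `M` is finite.
  refine ⟨M.sup n, fun j hj x => ?_⟩
  obtain ⟨m, hm, h₁, h₂⟩ := hM x
  exact (hf.monotone_apply i h₁).trans ((hn m).trans ((hg.mono ((Finset.le_sup hm).trans hj) m).trans
    (hg.monotone_apply j h₂)))

end IsFSSequence

open scoped Classical in
/-- The finitary compact generated by the members of a separating set that lie above `g x`. -/
noncomputable def separatorCompact (g : X → X) (M : Finset X)
    (h : ∀ x, ∃ m ∈ M, g x ≤ m ∧ m ≤ x) (x : X) : FinitaryCompact X :=
  ⟨upperClosure (M.filter (g x ≤ ·) : Finset X), _,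
    (h x).imp fun _ hm => Finset.mem_filter.2 ⟨hm.1, hm.2.1⟩, rfl⟩

theorem mem_separatorCompact {g : X → X} {M : Finset X} {h : ∀ x, ∃ m ∈ M, g x ≤ m ∧ m ≤ x}
    {x y : X} : y ∈ (separatorCompact g M h x).toSet ↔ ∃ m ∈ M, g x ≤ m ∧ m ≤ y := by
  simp [FinitaryCompact.toSet, separatorCompact, and_assoc]

theorem isControlledQuasiDeflation_separatorCompact {g : X → X} (hg : ScottContinuous g)
    {M : Finset X} (h : ∀ x, ∃ m ∈ M, g x ≤ m ∧ m ≤ x) :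
    IsControlledQuasiDeflation g (separatorCompact g M h) where
  control_scottContinuous := hg
  isQuasiDeflation :=
    { scottContinuous := by
        intro d hne hd a ha
        constructor
        · rintro _ ⟨x, hx, rfl⟩
          rw [FinitaryCompact.le_iff]
          intro y hy
          rw [mem_separatorCompact] at hy ⊢
          obtain ⟨m, hm, h₁, h₂⟩ := hy
          exact ⟨m, hm, (hg.monotone (ha.1 hx)).trans h₁, h₂⟩
        · intro b hb
          obtain ⟨e, he, hea⟩ := hg.exists_mem_forall_le_imp M hne hd ha
          refine le_trans ?_ (hb ⟨e, he, rfl⟩)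
          rw [FinitaryCompact.le_iff]
          intro y hy
          rw [mem_separatorCompact] at hy ⊢
          obtain ⟨m, hm, h₁, h₂⟩ := hy
          exact ⟨m, hm, hea m hm h₁, h₂⟩
      mem := fun x => mem_separatorCompact.2 (h x)
      finite_range := by
        classical
        refine Set.Finite.of_finite_image (f := Subtype.val) (((M.powerset.finite_toSet).image
          fun E : Finset X => upperClosure (E : Set X)).subset ?_) Subtype.val_injective.injOn
        rintro _ ⟨_, ⟨x, rfl⟩, rfl⟩
        exact ⟨_, Finset.mem_coe.2 (Finset.mem_powerset.2 (Finset.filter_subset _ _)), rfl⟩ }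
  subset_Ici x y hy := by
    obtain ⟨m, -, h₁, h₂⟩ := mem_separatorCompact.1 hy
    exact h₁.trans h₂

/-- Some generator of `φ x` lies below `x` because `x ∈ φ x`, and above `f x` by control; finitely
many values give finitely many generators. -/
theorem IsControlledQuasiDeflation.finitelySeparatedFromId {f : X → X} {φ : X → FinitaryCompact X}
    (h : IsControlledQuasiDeflation f φ) : FinitelySeparatedFromId f := by
  classical
  choose E hE using fun Q : FinitaryCompact X => Q.2
  refine ⟨h.isQuasiDeflation.finite_range.toFinset.biUnion E, fun x => ?_⟩
  have hmem := h.isQuasiDeflation.mem x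
  have hsub := h.subset_Ici x
  rw [FinitaryCompact.toSet, (hE (φ x)).2] at hmem hsub
  obtain ⟨m, hm, hmx⟩ := mem_upperClosure.1 hmem
  exact ⟨m, Finset.mem_biUnion.2 ⟨φ x, by simp, hm⟩, hsub (subset_upperClosure hm), hmx⟩

end Order

/-! ### The two characterizations of ωFS-domains. -/

section Characterizations

open scoped Topology

variable {X : Type u} [CompletePartialOrder X]

theorem IsControlledOmegaQRBDomain.isOmegaFSDomain (h : IsControlledOmegaQRBDomain X) :
    IsOmegaFSDomain X := by
  obtain ⟨f, φ, h₁, h₂, h₃⟩ := h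
  exact ⟨f, fun i => ⟨(h₁ i).control_scottContinuous, (h₁ i).finitelySeparatedFromId⟩,
    fun _ _ hij => (h₂ hij).1, h₃⟩

theorem IsOmegaFSDomain.isControlledOmegaQRBDomain (h : IsOmegaFSDomain X) :
    IsControlledOmegaQRBDomain X := by
  obtain ⟨f, hf⟩ := isOmegaFSDomain_iff.1 h
  -- A subsequence `F` is wanted in which each square lies below the next cube. The controls will be
  -- the cubes of `F`.
  have hstep : ∀ i, ∃ j, i < j ∧ ∀ x, f i (f i x) ≤ f j (f j (f j x)) := fun i => by
    obtain ⟨n, hn⟩ := hf.eventually_sq_le ((hf.comp hf).comp hf) i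
    exact ⟨max n (i + 1), by omega, hn _ (le_max_left _ _)⟩
  choose s hs hsq using hstep
  let n : ℕ → ℕ := fun i => s^[i] 0
  have hn : ∀ i, n (i + 1) = s (n i) := fun i => Function.iterate_succ_apply' s i 0
  have hF := hf.subsequence (strictMono_nat_of_lt_succ fun i => (hn i).symm ▸ hs (n i))
  have hFsq : ∀ i x, f (n i) (f (n i) x) ≤
      f (n (i + 1)) (f (n (i + 1)) (f (n (i + 1)) x)) := fun i x => (hn i).symm ▸ hsq (n i) x
  generalize hFdef : (fun i => f (n i)) = F at hF
  replace hFsq : ∀ i x, F i (F i x) ≤ F (i + 1) (F (i + 1) (F (i + 1) x)) := hFdef ▸ hFsq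
  choose M hM using hF.separated
  have hG := (hF.comp hF).comp hF
  have hle : ∀ i x, F i (F i (F i x)) ≤ F i x := fun i x =>
    (hF.le_self i _).trans (hF.le_self i _)
  have hsep : ∀ i x, ∃ m ∈ M i, (F i ∘ F i ∘ F i) x ≤ m ∧ m ≤ x := fun i x => by
    obtain ⟨m, hm, h₁, h₂⟩ := hM i x
    exact ⟨m, hm, (hle i x).trans h₁, h₂⟩
  refine ⟨_, fun i => separatorCompact _ (M i) (hsep i),
    fun i => isControlledQuasiDeflation_separatorCompact (hG.scottContinuous i) _,
    monotone_nat_of_le_succ fun i => ⟨hG.mono i.le_succ, fun x => ?_⟩, hG.isLUB⟩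
  rw [FinitaryCompact.le_iff]
  intro y hy
  rw [mem_separatorCompact] at hy ⊢
  obtain ⟨m, -, h₁, h₂⟩ := hy
  -- A generator `m` at stage `i + 1` is above `F i (F i x)`, so separating `m` from `F i m` gives a
  -- stage-`i` generator `m' ≤ m` above the cube.
  obtain ⟨m', hm', h₃, h₄⟩ := hM i m
  exact ⟨m', hm', ((hF.monotone_apply i ((hFsq i x).trans h₁))).trans h₃, h₄.trans h₂⟩

theorem isControlledOmegaQRBDomain_iff_isOmegaFSDomain :
    IsControlledOmegaQRBDomain X ↔ IsOmegaFSDomain X :=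
  ⟨fun h => h.isOmegaFSDomain, fun h => h.isControlledOmegaQRBDomain⟩

theorem isOpen_scott_iff {U : Set X} : IsOpen[Topology.scott X Set.univ] U ↔
    IsUpperSet U ∧ ∀ ⦃d : Set X⦄, d.Nonempty → DirectedOn (· ≤ ·) d → ∀ ⦃a⦄, IsLUB d a → a ∈ U →
      ∃ e ∈ d, e ∈ U := by
  let := Topology.scott X Set.univ
  have _ : Topology.IsScott X Set.univ := ⟨rfl⟩
  rw [Topology.IsScott.isOpen_iff_isUpperSet_and_dirSupInaccOn (D := Set.univ)]
  simp [DirSupInaccOn, Set.Nonempty]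

theorem ScottContinuous.isOpen_preimage {f : X → X} (hf : ScottContinuous f) {U : Set X}
    (hU : IsOpen[Topology.scott X Set.univ] U) : IsOpen[Topology.scott X Set.univ] (f ⁻¹' U) := by
  rw [isOpen_scott_iff] at hU ⊢
  refine ⟨hU.1.preimage hf.monotone, fun d hne hd a ha haU => ?_⟩
  obtain ⟨_, ⟨e, he, rfl⟩, heU⟩ := hU.2 (hne.image f) (hd.mono_comp hf.monotone) (hf hne hd ha) haU
  exact ⟨e, he, heU⟩

theorem isOpen_scott_compl_Iic (b : X) : IsOpen[Topology.scott X Set.univ] (Set.Iic b)ᶜ := by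
  refine isOpen_scott_iff.2 ⟨(isLowerSet_Iic b).compl, fun d _ _ a ha hab => ?_⟩
  by_contra! h
  exact hab (ha.2 fun x hx => not_not.1 (h x hx))

theorem IsOmegaFSDomain.isFSDomain (h : IsOmegaFSDomain X) : IsFSDomain X := by
  obtain ⟨f, h₁, h₂, h₃⟩ := h
  refine ⟨Set.range f, Set.range_nonempty f, h₂.directed_le.directedOn_range, ?_, fun x => ?_⟩
  · rintro _ ⟨i, rfl⟩
    exact h₁ i
  · rw [← Set.range_comp]
    exact h₃ x

theorem IsOmegaFSDomain.isCountablyBased (h : IsOmegaFSDomain X) : IsCountablyBased X := by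
  obtain ⟨f, hf⟩ := isOmegaFSDomain_iff.1 h
  choose M hM using hf.separated
  let := Topology.scott X Set.univ
  -- With `p.2` the separators above `f i x`, any `y` in this set has a separator between `f i x`
  -- and `y`, so the set lies in `↑ f i x`.
  let O : (ℕ × Finset X) → Set X := fun p => {y | ∀ m ∈ M p.1, f p.1 y ≤ m → m ∈ p.2}
  have hO : ∀ p, IsOpen (O p) := fun p => by
    refine isOpen_scott_iff.2 ⟨fun y z hyz hy m hm hle =>
      hy m hm ((hf.monotone_apply _ hyz).trans hle), fun d hne hd a ha haO => ?_⟩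
    obtain ⟨e, he, hea⟩ := (hf.scottContinuous p.1).exists_mem_forall_le_imp (M p.1) hne hd ha
    exact ⟨e, he, fun m hm hle => haO m hm (hea m hm hle)⟩
  let S : Set (ℕ × Finset X) := {p | p.2 ⊆ M p.1}
  have hS : S.Countable := by
    have : S ⊆ ⋃ i, (fun E => (i, E)) '' ((M i).powerset : Set (Finset X)) := fun p hp =>
      Set.mem_iUnion.2 ⟨p.1, p.2, Finset.mem_coe.2 (Finset.mem_powerset.2 hp), rfl⟩
    exact (Set.countable_iUnion fun i => ((Finset.finite_toSet _).image _).countable).mono this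
  refine (TopologicalSpace.isTopologicalBasis_of_isOpen_of_nhds (s := O '' S) ?_
    ?_).secondCountableTopology (hS.image O)
  · rintro _ ⟨p, -, rfl⟩
    exact hO p
  · classical
    intro x U hx hU
    obtain ⟨hup, hacc⟩ := isOpen_scott_iff.1 hU
    obtain ⟨_, ⟨i, rfl⟩, hi⟩ := hacc (Set.range_nonempty _)
      (show Monotone fun i => f i x from fun _ _ h => hf.mono h x).directed_le.directedOn_range
      (hf.isLUB x) hx
    refine ⟨_, ⟨(i, (M i).filter (f i x ≤ ·)), Finset.filter_subset _ _, rfl⟩, ?_, ?_⟩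
    · exact fun m hm hle => Finset.mem_filter.2 ⟨hm, hle⟩
    · intro y hy
      obtain ⟨m, hm, h₁, h₂⟩ := hM i y
      exact hup ((Finset.mem_filter.1 (hy m hm h₁)).2.trans h₂) hi

theorem IsFSDomain.isOmegaFSDomain (h : IsFSDomain X) (hX : IsCountablyBased X) :
    IsOmegaFSDomain X := by
  obtain ⟨D, hne, hdir, hD, hlub⟩ := h
  let := Topology.scott X Set.univ
  have _ : SecondCountableTopology X := hX
  have hB := TopologicalSpace.isBasis_countableBasis X
  obtain ⟨f₀, hf₀⟩ := hne
  -- One map per pair of basic opens, sending the first into the second if some member of `D` does;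
  -- otherwise the default `f₀`.
  have hchoice : ∀ p : TopologicalSpace.countableBasis X × TopologicalSpace.countableBasis X,
      ∃ f ∈ D, (∃ g ∈ D, Set.MapsTo g p.1.1 p.2.1) → Set.MapsTo f p.1.1 p.2.1 := fun p => by
    by_cases hp : ∃ g ∈ D, Set.MapsTo g p.1.1 p.2.1
    · obtain ⟨g, hg, hgp⟩ := hp
      exact ⟨g, hg, fun _ => hgp⟩
    · exact ⟨f₀, hf₀, fun h => absurd h hp⟩
  choose c hcD hc using hchoice
  obtain ⟨B₀, hB₀, -⟩ := hB.exists_subset_of_mem_open (Set.mem_univ (⊥ : X)) isOpen_univ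
  have _ : Nonempty (TopologicalSpace.countableBasis X) := ⟨⟨B₀, hB₀⟩⟩
  obtain ⟨e, he⟩ := exists_surjective_nat
    (TopologicalSpace.countableBasis X × TopologicalSpace.countableBasis X)
  choose! u hu hul hur using id hdir
  -- Directedness turns the countable selection into a chain whose term `k + 1` dominates the `k`-th
  -- selected map.
  let f : ℕ → D := fun n => n.rec ⟨f₀, hf₀⟩ fun k F =>
    ⟨u F.1 (c (e k)), hu _ F.2 _ (hcD _)⟩
  have hmono : Monotone fun n => (f n).1 := monotone_nat_of_le_succ fun n =>
    hul _ (f n).2 _ (hcD _)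
  refine ⟨fun n => (f n).1, fun n => hD _ (f n).2, hmono, fun x => ⟨?_, fun b hb => ?_⟩⟩
  · rintro _ ⟨n, rfl⟩
    exact (hlub x).1 ⟨_, (f n).2, rfl⟩
  · by_contra hxb
    obtain ⟨U, hUB, hxU, hUb⟩ := hB.exists_subset_of_mem_open
      (show x ∈ (Set.Iic b)ᶜ from hxb) (isOpen_scott_compl_Iic b)
    have hU := hB.isOpen hUB
    obtain ⟨_, ⟨g, hg, rfl⟩, hgU⟩ := (isOpen_scott_iff.1 hU).2 (Set.Nonempty.image _ ⟨f₀, hf₀⟩)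
      (hdir.mono_comp fun _ _ h => h x) (hlub x) hxU
    obtain ⟨V, hVB, hxV, hVU⟩ := hB.exists_subset_of_mem_open
      (show x ∈ g ⁻¹' U from hgU) ((hD g hg).1.isOpen_preimage hU)
    obtain ⟨n, hn⟩ := he (⟨V, hVB⟩, ⟨U, hUB⟩)
    have hcU : c (e n) x ∈ U := by
      rw [hn]
      exact hc (⟨V, hVB⟩, ⟨U, hUB⟩) ⟨g, hg, hVU⟩ hxV
    exact hUb hcU ((hur _ (f n).2 _ (hcD _) x).trans (hb ⟨n + 1, rfl⟩))

theorem isOmegaFSDomain_iff_isFSDomain_and_isCountablyBased :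
    IsOmegaFSDomain X ↔ IsFSDomain X ∧ IsCountablyBased X :=
  ⟨fun h => ⟨h.isFSDomain, h.isCountablyBased⟩, fun h => h.1.isOmegaFSDomain h.2⟩

end Characterizations

/-! ### Products and function spaces. -/

section Constructions

noncomputable instance Prod.instCompletePartialOrder {X Y : Type*} [CompletePartialOrder X]
    [CompletePartialOrder Y] : CompletePartialOrder (X × Y) where
  sSup S := (sSup (Prod.fst '' S), sSup (Prod.snd '' S))
  lubOfDirected _ hd := isLUB_prod.2
    ⟨(hd.mono_comp fun _ _ h => h.1).isLUB_sSup, (hd.mono_comp fun _ _ h => h.2).isLUB_sSup⟩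

instance PUnit.instCompletePartialOrder : CompletePartialOrder PUnit.{u + 1} where
  sSup _ := PUnit.unit
  lubOfDirected _ _ := ⟨fun _ _ => le_rfl, fun _ _ => le_rfl⟩

/-- The Scott-continuous maps between two posets, ordered pointwise. -/
abbrev ScottMap (X Y : Type*) [PartialOrder X] [PartialOrder Y] : Type _ :=
  {f : X → Y // ScottContinuous f}

/-- The two coordinates can be approximated independently, since directedness puts any `(p.1, q.2)`
below one element of `d`. -/
theorem ScottContinuous.of_prod {X Y Z : Type*} [PartialOrder X] [PartialOrder Y] [PartialOrder Z]
    {f : X × Y → Z} (h₁ : ∀ y, ScottContinuous fun x => f (x, y))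
    (h₂ : ∀ x, ScottContinuous fun y => f (x, y)) : ScottContinuous f := by
  have hmono : Monotone f := fun p q h =>
    ((h₁ p.2).monotone h.1).trans ((h₂ q.1).monotone h.2)
  intro d hne hd a ha
  refine ⟨?_, fun b hb => ?_⟩
  · rintro _ ⟨p, hp, rfl⟩
    exact hmono (ha.1 hp)
  · have ha' := isLUB_prod.1 ha
    refine (h₁ a.2 (hne.image _) (hd.mono_comp fun _ _ h => h.1) ha'.1).2 ?_
    rintro _ ⟨_, ⟨p, hp, rfl⟩, rfl⟩
    refine (h₂ p.1 (hne.image _) (hd.mono_comp fun _ _ h => h.2) ha'.2).2 ?_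
    rintro _ ⟨_, ⟨q, hq, rfl⟩, rfl⟩
    obtain ⟨r, hr, hpr, hqr⟩ := hd p hp q hq
    exact (hmono (show (p.1, q.2) ≤ r from ⟨hpr.1, hqr.2⟩)).trans (hb ⟨r, hr, rfl⟩)

namespace ScottMap

variable {X Y Z : Type*}

theorem directedOn_eval [PartialOrder X] [PartialOrder Y] {S : Set (ScottMap X Y)}
    (hS : DirectedOn (· ≤ ·) S) (x : X) : DirectedOn (· ≤ ·) ((fun f : ScottMap X Y => f.1 x) '' S) :=
  hS.mono_comp fun _ _ h => h x

theorem isLUB_of_eval [PartialOrder X] [PartialOrder Y] {S : Set (ScottMap X Y)}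
    {g : ScottMap X Y} (h : ∀ x, IsLUB ((fun f : ScottMap X Y => f.1 x) '' S) (g.1 x)) :
    IsLUB S g :=
  ⟨fun f hf x => (h x).1 ⟨f, hf, rfl⟩, fun b hb x => (h x).2 (by
    rintro _ ⟨f, hf, rfl⟩
    exact hb hf x)⟩

/-- The pointwise supremum of a directed set of Scott-continuous maps. -/
def directedSup [PartialOrder X] [CompletePartialOrder Y] (S : Set (ScottMap X Y))
    (hS : DirectedOn (· ≤ ·) S) : ScottMap X Y :=
  ⟨fun x => sSup ((fun f : ScottMap X Y => f.1 x) '' S), by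
    intro d hne hd a ha
    refine ⟨?_, fun b hb => ?_⟩
    · rintro _ ⟨x, hx, rfl⟩
      refine (directedOn_eval hS x).sSup_le ?_
      rintro _ ⟨f, hf, rfl⟩
      exact (f.2.monotone (ha.1 hx)).trans ((directedOn_eval hS a).le_sSup ⟨f, hf, rfl⟩)
    · refine (directedOn_eval hS a).sSup_le ?_
      rintro _ ⟨f, hf, rfl⟩
      refine (f.2 hne hd ha).2 ?_
      rintro _ ⟨x, hx, rfl⟩
      exact ((directedOn_eval hS x).le_sSup ⟨f, hf, rfl⟩).trans (hb ⟨x, hx, rfl⟩)⟩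

open scoped Classical in
noncomputable instance instCompletePartialOrder [PartialOrder X] [CompletePartialOrder Y] :
    CompletePartialOrder (ScottMap X Y) where
  -- The bottom map is a junk value on sets that are not directed.
  sSup S := if hS : DirectedOn (· ≤ ·) S then directedSup S hS else ⟨fun _ => ⊥, .const ⊥⟩
  bot := ⟨fun _ => ⊥, .const ⊥⟩
  bot_le _ _ := bot_le
  lubOfDirected S hS := by
    rw [dif_pos hS]
    exact isLUB_of_eval fun x => (directedOn_eval hS x).isLUB_sSup

theorem isLUB_eval [PartialOrder X] [CompletePartialOrder Y] {S : Set (ScottMap X Y)}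
    (hS : DirectedOn (· ≤ ·) S) {g : ScottMap X Y} (hg : IsLUB S g) (x : X) :
    IsLUB ((fun f : ScottMap X Y => f.1 x) '' S) (g.1 x) := by
  have : g = directedSup S hS :=
    hg.unique (isLUB_of_eval fun x => (directedOn_eval hS x).isLUB_sSup)
  rw [this]
  exact (directedOn_eval hS x).isLUB_sSup

theorem scottContinuous_eval [PartialOrder X] [CompletePartialOrder Y] (x : X) :
    ScottContinuous fun f : ScottMap X Y => f.1 x :=
  fun _ _ hd _ ha => isLUB_eval hd ha x

theorem scottContinuous_iff_eval [PartialOrder X] [CompletePartialOrder Y] [PartialOrder Z]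
    {F : Z → ScottMap X Y} : ScottContinuous F ↔ ∀ x, ScottContinuous fun z => (F z).1 x := by
  refine ⟨fun h x => h.comp (scottContinuous_eval x), fun h d hne hd a ha => ?_⟩
  refine isLUB_of_eval fun x => ?_
  rw [Set.image_image]
  exact h x hne hd ha

/-- The map `h ↦ g ∘ h ∘ f` on Scott-continuous maps. -/
def conj [PartialOrder X] [PartialOrder Y] (f : ScottMap X X) (g : ScottMap Y Y)
    (h : ScottMap X Y) : ScottMap X Y :=
  ⟨g.1 ∘ h.1 ∘ f.1, (f.2.comp h.2).comp g.2⟩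

theorem scottContinuous_conj [PartialOrder X] [CompletePartialOrder Y] (f : ScottMap X X)
    (g : ScottMap Y Y) : ScottContinuous (conj f g) :=
  scottContinuous_iff_eval.2 fun x => (scottContinuous_eval (f.1 x)).comp g.2

/-- A finite record of how `h` acts on separators determines `h` up to one conjugation. With `r` a
representative having the record of `h`, the double conjugate of `h` is below the conjugate of `r`,
which is below `h`. -/
theorem finitelySeparatedFromId_conj_conj [PartialOrder X] [PartialOrder Y]
    {f : ScottMap X X} {g : ScottMap Y Y} (hf : FinitelySeparatedFromId f.1)
    (hg : FinitelySeparatedFromId g.1) :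
    FinitelySeparatedFromId fun h : ScottMap X Y => conj f g (conj f g h) := by
  classical
  obtain ⟨M, hM⟩ := hf
  obtain ⟨N, hN⟩ := hg
  let S : ScottMap X Y → Finset (X × Y) := fun h =>
    (M ×ˢ N).filter fun p => g.1 (h.1 p.1) ≤ p.2 ∧ p.2 ≤ h.1 p.1
  have key : ∀ h h' : ScottMap X Y, S h = S h' → conj f g h ≤ h' := by
    intro h h' hS x
    obtain ⟨m, hm, hm₁, hm₂⟩ := hM x
    obtain ⟨n, hn, hn₁, hn₂⟩ := hN (h.1 m)
    have : (m, n) ∈ S h' := hS ▸ Finset.mem_filter.2 ⟨Finset.mk_mem_product hm hn, hn₁, hn₂⟩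
    exact (g.2.monotone (h.2.monotone hm₁)).trans
      (hn₁.trans ((Finset.mem_filter.1 this).2.2.trans (h'.2.monotone hm₂)))
  have hfin : (Set.range S).Finite := (M ×ˢ N).powerset.finite_toSet.subset (by
    rintro _ ⟨h, rfl⟩
    exact Finset.mem_coe.2 (Finset.mem_powerset.2 (Finset.filter_subset _ _)))
  choose r hr using fun T : Set.range S => T.2
  have hfin' : Finite (Set.range S) := hfin
  refine ⟨(Set.finite_range fun T => conj f g (r T)).toFinset, fun h => ?_⟩
  have hS : S (r ⟨S h, h, rfl⟩) = S h := hr ⟨S h, h, rfl⟩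
  refine ⟨conj f g (r ⟨S h, h, rfl⟩), by simp, ?_, key _ _ hS⟩
  exact fun x => g.2.monotone (key _ _ hS.symm (f.1 x))

end ScottMap

variable {X Y : Type*}

theorem isOmegaFSDomain_punit : IsOmegaFSDomain PUnit.{u + 1} :=
  ⟨fun _ => id, fun _ => ⟨.id, {PUnit.unit}, fun _ => ⟨PUnit.unit, by simp, le_rfl, le_rfl⟩⟩,
    fun _ _ _ => le_rfl, fun _ => ⟨fun _ _ => le_rfl, fun _ _ => le_rfl⟩⟩

theorem FinitelySeparatedFromId.prodMap [PartialOrder X] [PartialOrder Y] {f : X → X} {g : Y → Y}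
    (hf : FinitelySeparatedFromId f) (hg : FinitelySeparatedFromId g) :
    FinitelySeparatedFromId (Prod.map f g) := by
  obtain ⟨M, hM⟩ := hf
  obtain ⟨N, hN⟩ := hg
  refine ⟨M ×ˢ N, fun p => ?_⟩
  obtain ⟨m, hm, hm₁, hm₂⟩ := hM p.1
  obtain ⟨n, hn, hn₁, hn₂⟩ := hN p.2
  exact ⟨(m, n), Finset.mk_mem_product hm hn, ⟨hm₁, hn₁⟩, ⟨hm₂, hn₂⟩⟩

theorem IsFSSequence.prodMap [PartialOrder X] [PartialOrder Y] {f : ℕ → X → X} {g : ℕ → Y → Y}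
    (hf : IsFSSequence f) (hg : IsFSSequence g) : IsFSSequence fun i => Prod.map (f i) (g i) where
  scottContinuous i := (ScottContinuous.fst.comp (hf.scottContinuous i)).prodMk
    (ScottContinuous.snd.comp (hg.scottContinuous i))
  separated i := (hf.separated i).prodMap (hg.separated i)
  mono _ _ h p := ⟨hf.mono h p.1, hg.mono h p.2⟩
  isLUB p := by
    rw [isLUB_prod, ← Set.range_comp, ← Set.range_comp]
    exact ⟨hf.isLUB p.1, hg.isLUB p.2⟩

/-- Double conjugation is `h ↦ g² ∘ h ∘ f²`, so order and suprema reduce to the FS-sequences of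
squares. -/
theorem IsFSSequence.conj_conj [PartialOrder X] [CompletePartialOrder Y] {f : ℕ → X → X}
    {g : ℕ → Y → Y} (hf : IsFSSequence f) (hg : IsFSSequence g) :
    IsFSSequence fun i (h : ScottMap X Y) =>
      ScottMap.conj ⟨f i, hf.scottContinuous i⟩ ⟨g i, hg.scottContinuous i⟩
        (ScottMap.conj ⟨f i, hf.scottContinuous i⟩ ⟨g i, hg.scottContinuous i⟩ h) where
  scottContinuous i := (ScottMap.scottContinuous_conj _ _).comp (ScottMap.scottContinuous_conj _ _)
  separated i := ScottMap.finitelySeparatedFromId_conj_conj (hf.separated i) (hg.separated i)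
  mono i j hij h x := (hg.comp hg).mono hij _ |>.trans
    ((hg.comp hg).monotone_apply j (h.2.monotone ((hf.comp hf).mono hij x)))
  isLUB h := by
    refine ⟨?_, fun b hb x => ?_⟩
    · rintro _ ⟨i, rfl⟩ x
      exact ((hg.comp hg).le_self i _).trans (h.2.monotone ((hf.comp hf).le_self i x))
    · have hmono : Monotone fun i => (f i ∘ f i) x := fun _ _ hij => (hf.comp hf).mono hij x
      refine (h.2 (Set.range_nonempty _) hmono.directed_le.directedOn_range
        ((hf.comp hf).isLUB x)).2 ?_
      rintro _ ⟨_, ⟨k, rfl⟩, rfl⟩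
      refine ((hg.comp hg).isLUB _).2 ?_
      rintro _ ⟨n, rfl⟩
      refine le_trans ?_ (hb ⟨max n k, rfl⟩ x)
      exact ((hg.comp hg).mono (le_max_left n k) _).trans ((hg.comp hg).monotone_apply _
        (h.2.monotone (hmono (le_max_right n k))))

variable [CompletePartialOrder X] [CompletePartialOrder Y]

theorem IsOmegaFSDomain.prod (hX : IsOmegaFSDomain X) (hY : IsOmegaFSDomain Y) :
    IsOmegaFSDomain (X × Y) := by
  obtain ⟨f, hf⟩ := isOmegaFSDomain_iff.1 hX
  obtain ⟨g, hg⟩ := isOmegaFSDomain_iff.1 hY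
  exact isOmegaFSDomain_iff.2 ⟨_, hf.prodMap hg⟩

theorem IsOmegaFSDomain.scottMap (hX : IsOmegaFSDomain X) (hY : IsOmegaFSDomain Y) :
    IsOmegaFSDomain (ScottMap X Y) := by
  obtain ⟨f, hf⟩ := isOmegaFSDomain_iff.1 hX
  obtain ⟨g, hg⟩ := isOmegaFSDomain_iff.1 hY
  exact isOmegaFSDomain_iff.2 ⟨_, hf.conj_conj hg⟩

end Constructions

/-! ### The Cartesian closed structure. -/

section CartesianClosed

open Limits MonoidalCategory

namespace ControlledOmegaQRB

/-- The category of controlled `ωQRB`-domains and Scott-continuous maps. -/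
abbrev Dom : Type (u + 1) := (controlledOmegaQRB.{u}).FullSubcategory

/-- A controlled `ωQRB`-domain, bundled. -/
def of (X : Type u) [CompletePartialOrder X] (h : IsOmegaFSDomain X) : Dom.{u} :=
  ⟨⟨X⟩, h.isControlledOmegaQRBDomain⟩

theorem isOmegaFSDomain (X : Dom.{u}) : IsOmegaFSDomain X.obj :=
  IsControlledOmegaQRBDomain.isOmegaFSDomain X.property

/-- A Scott-continuous map as a morphism. -/
def ofHom {X Y : Dom.{u}} (f : X.obj → Y.obj) (hf : ScottContinuous f) : X ⟶ Y :=
  ObjectProperty.homMk ⟨f, hf⟩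

/-- The map underlying a morphism. -/
def fn {X Y : Dom.{u}} (f : X ⟶ Y) : X.obj → Y.obj := f.hom.1

theorem scottContinuous_fn {X Y : Dom.{u}} (f : X ⟶ Y) : ScottContinuous (fn f) := f.hom.2

theorem hom_ext {X Y : Dom.{u}} {f g : X ⟶ Y} (h : ∀ x, fn f x = fn g x) : f = g :=
  ObjectProperty.hom_ext _ (Subtype.ext (funext h))

/-- The one-point domain is terminal. -/
def terminalCone : LimitCone (Functor.empty.{0} Dom.{u}) where
  cone := asEmptyCone (of PUnit.{u + 1} isOmegaFSDomain_punit)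
  isLimit := IsTerminal.ofUniqueHom (fun _ => ofHom (fun _ => PUnit.unit) (.const _))
    fun _ _ => hom_ext fun _ => rfl

/-- The product of two domains. -/
noncomputable def prodObj (X Y : Dom.{u}) : Dom.{u} :=
  of (X.obj × Y.obj) ((isOmegaFSDomain X).prod (isOmegaFSDomain Y))

/-- The product of two domains is their categorical product. -/
noncomputable def prodCone (X Y : Dom.{u}) : LimitCone (pair X Y) where
  cone := BinaryFan.mk (P := prodObj X Y) (ofHom Prod.fst .fst) (ofHom Prod.snd .snd)
  isLimit := BinaryFan.IsLimit.mk _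
    (fun f g => ofHom (fun t => (fn f t, fn g t))
      ((scottContinuous_fn f).prodMk (scottContinuous_fn g)))
    (fun _ _ => rfl) (fun _ _ => rfl)
    (fun _ _ _ h₁ h₂ => by
      subst h₁ h₂
      rfl)

noncomputable instance instCartesianMonoidalCategory : CartesianMonoidalCategory Dom.{u} :=
  .ofChosenFiniteProducts terminalCone prodCone

/-- The domain of Scott-continuous maps between two domains. -/
noncomputable def homObj (X Y : Dom.{u}) : Dom.{u} :=
  of (ScottMap X.obj Y.obj) ((isOmegaFSDomain X).scottMap (isOmegaFSDomain Y))

/-- Morphisms out of a product correspond to morphisms into a function space. -/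
noncomputable def curryEquiv (A X Y : Dom.{u}) : (A ⊗ X ⟶ Y) ≃ (X ⟶ homObj A Y) where
  toFun f := ofHom (Y := homObj A Y)
    (fun x => ⟨fun a => fn (X := prodObj A X) f (a, x),
      (ScottContinuous.prodMk .id (.const x)).comp (scottContinuous_fn (X := prodObj A X) f)⟩)
    (ScottMap.scottContinuous_iff_eval.2 fun a =>
      (ScottContinuous.prodMk (.const a) .id).comp (scottContinuous_fn (X := prodObj A X) f))
  invFun g := ofHom (X := prodObj A X) (fun p => (fn (Y := homObj A Y) g p.2).1 p.1)
    (ScottContinuous.of_prod (fun x => (fn (Y := homObj A Y) g x).2)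
      (ScottMap.scottContinuous_iff_eval.1 (scottContinuous_fn (Y := homObj A Y) g)))
  left_inv _ := rfl
  right_inv _ := rfl

noncomputable instance instMonoidalClosed : MonoidalClosed Dom.{u} where
  closed A :=
    { rightAdj := Adjunction.rightAdjointOfEquiv (F := tensorLeft A)
        (curryEquiv A) fun _ _ _ _ _ => rfl
      adj := Adjunction.adjunctionOfEquivRight (F := tensorLeft A)
        (curryEquiv A) fun _ _ _ _ _ => rfl }

end ControlledOmegaQRB

end CartesianClosed

theorem mainTheorem10 :
    (∀ (X : Type u) [CompletePartialOrder X],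
      (IsControlledOmegaQRBDomain X ↔ IsOmegaFSDomain X) ∧
      (IsOmegaFSDomain X ↔ IsFSDomain X ∧ IsCountablyBased X)) ∧
    IsCartesianClosed (controlledOmegaQRB.{u}).FullSubcategory := by
  exact ⟨fun _ _ => ⟨isControlledOmegaQRBDomain_iff_isOmegaFSDomain,
    isOmegaFSDomain_iff_isFSDomain_and_isCountablyBased⟩,
    ControlledOmegaQRB.instCartesianMonoidalCategory, ⟨ControlledOmegaQRB.instMonoidalClosed⟩⟩
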